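/- Let $G$ be a connected finite simple graph with $n\ge 1$ nodes and all edge weights equal to $1$, let $L_G$ be its Laplacian matrix with eigenvalues $0=\lambda_1\le\lambda_2\le\dots\le\lambda_n$, and let $M_n=I_n-\frac1n J_n$, where $J_n$ is the $n\times n$ all-ones matrix. Consider the first-order consensus network $$\dot x=-L_G x+\xi,\qquad y=Cx,\qquad C^{\mathsf T}C=M_n,$$ driven by a white noise $\xi$ with zero mean and identity covariance matrix (that is, $x(t)=x(0)-\int_0^t L_Gx(s)\,ds+W(t)$ for $t\ge 0$, where $W$ has almost surely continuous paths, zero mean and $\mathbb E[W_i(s)W_j(t)]=\delta_{ij}\min(s,t)$), with square-integrable initial state $x(0)$. Its steady-state output variance $$\rho_{ss}(L_G;M_n)=\lim_{t\to\infty}\mathbb E\big[y(t)^{\mathsf T}y(t)\big]$$ is $\rho_{ss}(L_G;M_n)=\frac12\sum_{i=2}^n\lambda_i^{-1}$, and $$\frac12-\frac1{2n}\;\le\;\rho_{ss}(L_G;M_n)\;\le\;\frac{n^2-1}{12}.$$ Equality holds in the lower bound if and only if $G$ is (isomorphic to) the complete graph $K_n$, and in the upper bound if and only if $G$ is (isomorphic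 to) the path graph $P_n$. -/

import Mathlib

open MeasureTheory Filter Topology

universe u v

namespace ConsensusNetwork

/-- `W` is the time integral of a white noise on `V → ℝ` with zero mean and identity covariance
matrix: its coordinates have zero mean and `𝔼[W_i(s) W_j(t)] = δ_{ij} min(s, t)`, and its paths are
almost surely continuous. A standard Brownian motion on `V → ℝ` is the Gaussian example. -/
structure IsIntegratedWhiteNoise {V : Type v} [DecidableEq V]
    {Ω : Type u} [MeasurableSpace Ω] (P : Measure Ω) (W : ℝ → Ω → V → ℝ) : Prop where
  measurable : ∀ t, 0 ≤ t → Measurable (W t)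
  continuousOn : ∀ᵐ ω ∂P, ContinuousOn (fun t => W t ω) (Set.Ici 0)
  memLp : ∀ t, 0 ≤ t → ∀ i, MemLp (fun ω => W t ω i) 2 P
  mean : ∀ t, 0 ≤ t → ∀ i, ∫ ω, W t ω i ∂P = 0
  covariance : ∀ s t, 0 ≤ s → 0 ≤ t → ∀ i j,
    ∫ ω, W s ω i * W t ω j ∂P = if i = j then min s t else 0

/-- `x` solves the noisy system `ẋ = -A x + ξ` for `t ≥ 0`, where `W` is the time integral of the
noise `ξ`, with a square-integrable initial state. As the noise is additive, the equation is an
integral equation along almost every path. -/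
structure IsTrajectory {V : Type v} [Fintype V]
    {Ω : Type u} [MeasurableSpace Ω] (P : Measure Ω) (A : Matrix V V ℝ)
    (W x : ℝ → Ω → V → ℝ) : Prop where
  initial : ∀ i, MemLp (fun ω => x 0 ω i) 2 P
  continuousOn : ∀ᵐ ω ∂P, ContinuousOn (fun t => x t ω) (Set.Ici 0)
  equation : ∀ᵐ ω ∂P, ∀ t, 0 ≤ t → ∀ i,
    x t ω i = x 0 ω i + (∫ s in (0 : ℝ)..t, -(A.mulVec (x s ω) i)) + W t ω i

/-- `ρ` is the performance measure `ρ_ss(A; L_Q)` of the first-order network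
`ẋ = -A x + ξ`, `y = C x` with `Cᵀ C = L_Q`, that is `ρ = lim_{t → ∞} 𝔼[y(t)ᵀ y(t)]`, for every
output matrix `C` with `Cᵀ C = L_Q` and every realization of the noise and of the state. -/
def HasPerformanceMeasure {V : Type v} [Fintype V] [DecidableEq V]
    (A LQ : Matrix V V ℝ) (ρ : ℝ) : Prop :=
  ∀ (m : ℕ) (C : Matrix (Fin m) V ℝ), C.transpose * C = LQ →
  ∀ (Ω : Type u) [MeasurableSpace Ω] (P : Measure Ω) [IsProbabilityMeasure P]
    (W x : ℝ → Ω → V → ℝ),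
    IsIntegratedWhiteNoise P W → IsTrajectory P A W x →
      (∀ t, 0 ≤ t → Integrable (fun ω => C.mulVec (x t ω) ⬝ᵥ C.mulVec (x t ω)) P) ∧
      Tendsto (fun t : ℝ => ∫ ω, C.mulVec (x t ω) ⬝ᵥ C.mulVec (x t ω) ∂P) atTop (𝓝 ρ)

/-- The centering matrix `M_n = I - (1/n) J`, where `J` is the all-ones matrix. -/
noncomputable def centeringMatrix (V : Type v) [Fintype V] [DecidableEq V] : Matrix V V ℝ :=
  1 - (1 / (Fintype.card V : ℝ)) • Matrix.of (fun _ _ => (1 : ℝ))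

/-- The Laplacian eigenvalues with multiplicity in ascending order, `λ_1 ≤ ⋯ ≤ λ_n`; the index
`i : Fin n` stands for the position `i + 1`. -/
noncomputable def lapEigenvalue {V : Type v} [Fintype V] [DecidableEq V]
    (G : SimpleGraph V) [DecidableRel G.Adj] (i : Fin (Fintype.card V)) : ℝ :=
  (G.isHermitian_lapMatrix (R := ℝ)).eigenvalues₀ i.rev

/-- The quantity `(1/2) ∑_{i = 2}^n 1 / λ_i`. -/
noncomputable def rhoSS {V : Type v} [Fintype V] [DecidableEq V]
    (G : SimpleGraph V) [DecidableRel G.Adj] : ℝ :=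
  (1 / 2) * ∑ i : Fin (Fintype.card V) with 1 ≤ i.val, (lapEigenvalue G i)⁻¹

end ConsensusNetwork

/-!
The Laplacian is diagonalised in an orthonormal eigenbasis `u_k` with eigenvalues `μ_k`, and the sum
of the inverse eigenvalues is compared with combinatorial quantities of the graph.

*Performance measure.* The centering matrix is the orthogonal projection onto the eigenvectors with
`μ_k ≠ 0`, so `yᵀ y` is the sum of the `z_k ^ 2`, where `z_k = u_k ⬝ᵥ x` solves a scalar equation
`z' = -μ_k z + w'` whose noise `w` again has covariance `min s t`. Its solution is
`e^{-μ t} z(0) + v(t)` with `v(t) = w(t) - μ ∫₀ᵗ e^{-μ (t - s)} w(s) ds`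
(`eq_of_integral_equation`), and Fubini's theorem gives `𝔼[v(t)²] = (1 - e^{-2μt}) / (2μ)`
(`IsScalarNoise.integral_sq_ornsteinUhlenbeck`). The initial state decays in `L²`, so no
independence from the noise is needed, and `𝔼[z_k²] → 1 / (2μ_k)`.

*Lower bound.* The tangent line bound `1/μ ≥ 2/n - μ/n²` reduces the claim to `tr L ≤ n (n - 1)`,
where equality forces all degrees to be `n - 1`; on the complete graph all nonzero eigenvalues
equal `n`.

*Upper bound.* The effective resistances `R_ij` sum to `2n ∑ μ_k⁻¹` (`sum_effResistance`), and
`R_ij ≤ dist i j` by the Cauchy–Schwarz inequality along a shortest path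
(`effResistance_le_dist`). The sum of all distances is at most that of a path: remove a vertex `v`
that does not disconnect the graph, and use that the distances from `v` leave no gaps
(`three_mul_sum_dist_add_card_le`). Equality forces all distances from `v` to differ, which makes
the graph a path. Conversely, on a path the Dirichlet principle, tested with a clamped position
function, gives `R_ij ≥ |i - j|`.
-/

namespace ConsensusNetwork

/-! ### Distance sums in connected graphs -/

section Combinatorics

variable {V : Type v} [Fintype V]

/-- If the values of `f` leave no gaps, `f u` is at most the number of vertices with a smaller
value, since each level below `f u` is occupied. Summing over `u` counts every unordered pair at
most once, and pairs with equal values not at all. -/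
theorem two_mul_sum_add_card_eq_le (f : V → ℕ) (hf : ∀ u, ∀ j < f u, ∃ w, f w = j) :
    2 * ∑ u, f u + (Finset.univ.filter fun p : V × V => f p.1 = f p.2).card
      ≤ Fintype.card V ^ 2 := by
  classical
  have hle : ∀ u, f u ≤ (Finset.univ.filter fun w => f w < f u).card := by
    intro u
    have hsub : Finset.range (f u) ⊆ (Finset.univ.filter fun w => f w < f u).image f := by
      intro j hj
      obtain ⟨w, hw⟩ := hf u j (Finset.mem_range.1 hj)
      exact Finset.mem_image.2 ⟨w, by simpa [hw] using hj, hw⟩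
    simpa using (Finset.card_le_card hsub).trans Finset.card_image_le
  have hsum : ∑ u, f u ≤ (Finset.univ.filter fun p : V × V => f p.2 < f p.1).card := by
    refine (Finset.sum_le_sum fun u _ => hle u).trans_eq ?_
    simp only [Finset.card_filter, ← Finset.univ_product_univ, Finset.sum_product]
  have hswap : (Finset.univ.filter fun p : V × V => f p.1 < f p.2).card =
      (Finset.univ.filter fun p : V × V => f p.2 < f p.1).card :=
    Finset.card_equiv (Equiv.prodComm V V) (by simp)
  have htot : (Finset.univ.filter fun p : V × V => f p.1 < f p.2).card +
      (Finset.univ.filter fun p : V × V => f p.2 < f p.1).card +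
      (Finset.univ.filter fun p : V × V => f p.1 = f p.2).card = Fintype.card V ^ 2 := by
    rw [sq, ← Fintype.card_prod, ← Finset.card_univ, Finset.card_filter, Finset.card_filter,
      Finset.card_filter, ← Finset.sum_add_distrib, ← Finset.sum_add_distrib,
      Finset.card_eq_sum_ones]
    refine Finset.sum_congr rfl fun p _ => ?_
    split_ifs <;> omega
  omega

theorem card_le_card_filter_eq (f : V → ℕ) :
    Fintype.card V ≤ (Finset.univ.filter fun p : V × V => f p.1 = f p.2).card := by
  rw [← Finset.card_univ]
  exact Finset.card_le_card_of_injOn (fun u => (u, u)) (by simp [Set.MapsTo])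
    (fun a _ b _ h => (Prod.ext_iff.1 h).1)

theorem injective_of_card_filter_eq_le (f : V → ℕ)
    (h : (Finset.univ.filter fun p : V × V => f p.1 = f p.2).card ≤ Fintype.card V) :
    Function.Injective f := by
  classical
  have hsub : Finset.univ.image (fun u : V => (u, u)) ⊆
      Finset.univ.filter fun p : V × V => f p.1 = f p.2 := by
    intro p hp
    obtain ⟨u, -, rfl⟩ := Finset.mem_image.1 hp
    simp
  have heq := Finset.eq_of_subset_of_card_le hsub (by
    rw [Finset.card_image_of_injective _ fun a b h => (Prod.ext_iff.1 h).1]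
    simpa using h)
  intro a b hab
  have : (a, b) ∈ Finset.univ.image (fun u : V => (u, u)) := by
    rw [heq]; simpa using hab
  obtain ⟨u, -, hu⟩ := Finset.mem_image.1 this
  exact (Prod.ext_iff.1 hu).1.symm.trans (Prod.ext_iff.1 hu).2

variable {G : SimpleGraph V}

omit [Fintype V] in
theorem exists_adj_dist_eq (hG : G.Connected) {v u : V} {k : ℕ} (h : G.dist v u = k + 1) :
    ∃ w, G.Adj w u ∧ G.dist v w = k := by
  obtain ⟨p, hp⟩ := hG.exists_walk_length_eq_dist u v
  rw [SimpleGraph.dist_comm, h] at hp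
  cases p with
  | nil => simp at hp
  | @cons _ w _ hadj q =>
    refine ⟨w, hadj.symm, ?_⟩
    have h1 := SimpleGraph.dist_le q
    rw [SimpleGraph.Walk.length_cons] at hp
    have h2 := hG.dist_triangle (u := v) (v := w) (w := u)
    have h3 := SimpleGraph.dist_eq_one_iff_adj.2 hadj.symm
    rw [SimpleGraph.dist_comm] at h1
    omega

omit [Fintype V] in
theorem exists_dist_eq_of_lt (hG : G.Connected) (v : V) :
    ∀ u, ∀ j < G.dist v u, ∃ w, G.dist v w = j := by
  suffices h : ∀ d u, G.dist v u = d → ∀ j < d, ∃ w, G.dist v w = j from fun u => h _ u rfl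
  intro d
  induction d with
  | zero => intro u _ j hj; omega
  | succ d ih =>
    intro u hu j hj
    obtain ⟨w, -, hw⟩ := exists_adj_dist_eq hG hu
    rcases Nat.lt_succ_iff_lt_or_eq.1 hj with h | rfl
    · exact ih w hw j h
    · exact ⟨w, hw⟩

theorem two_mul_sum_dist_add_card_le (hG : G.Connected) (v : V) :
    2 * ∑ u, G.dist v u + Fintype.card V ≤ Fintype.card V ^ 2 := by
  have h1 := two_mul_sum_add_card_eq_le (G.dist v) (exists_dist_eq_of_lt hG v)
  have h2 := card_le_card_filter_eq (G.dist v)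
  omega

/-- A vertex from which all distances differ is an end of a path: the distance is then an
isomorphism onto the path graph. -/
theorem nonempty_iso_pathGraph_of_injective_dist (hG : G.Connected) (v : V)
    (hinj : Function.Injective (G.dist v)) :
    Nonempty (G ≃g SimpleGraph.pathGraph (Fintype.card V)) := by
  classical
  have hlt : ∀ u, G.dist v u < Fintype.card V := by
    intro u
    obtain ⟨p, hp, hl⟩ := hG.exists_path_of_dist v u
    exact hl ▸ hp.length_lt
  let φ : V → Fin (Fintype.card V) := fun u => ⟨G.dist v u, hlt u⟩
  have hφ : Function.Bijective φ :=
    (Fintype.bijective_iff_injective_and_card φ).2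
      ⟨fun a b h => hinj (congrArg Fin.val h), by simp⟩
  have key : ∀ a b, G.dist v a + 1 = G.dist v b → G.Adj a b := by
    intro a b hab
    obtain ⟨w, hw, hd⟩ := exists_adj_dist_eq hG hab.symm
    exact hinj hd ▸ hw
  refine ⟨⟨Equiv.ofBijective φ hφ, fun {a b} => ?_⟩⟩
  simp only [Equiv.ofBijective_apply, SimpleGraph.pathGraph_adj, φ]
  constructor
  · rintro (h | h)
    · exact key a b h
    · exact (key b a h).symm
  · intro hab
    have h1 := hG.dist_triangle (u := v) (v := a) (w := b)
    have h2 := hG.dist_triangle (u := v) (v := b) (w := a)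
    rw [SimpleGraph.dist_eq_one_iff_adj.2 hab] at h1
    rw [SimpleGraph.dist_eq_one_iff_adj.2 hab.symm] at h2
    have h3 : G.dist v a ≠ G.dist v b := fun h => hab.ne (hinj h)
    omega

theorem sum_sum_dist_split [DecidableEq V] (v : V) :
    ∑ a, ∑ b, G.dist a b = 2 * ∑ u, G.dist v u +
      ∑ a : {a : V // a ≠ v}, ∑ b : {b : V // b ≠ v}, G.dist a b := by
  rw [Fintype.sum_eq_add_sum_subtype_ne _ v,
    Finset.sum_congr rfl fun (a : {a : V // a ≠ v}) _ =>
      Fintype.sum_eq_add_sum_subtype_ne (fun b => G.dist a b) v,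
    Finset.sum_add_distrib, Fintype.sum_eq_add_sum_subtype_ne (fun b => G.dist v b) v]
  simp only [SimpleGraph.dist_self, zero_add, fun a : {a : V // a ≠ v} =>
    SimpleGraph.dist_comm (G := G) (u := a) (v := v)]
  ring

theorem sum_dist_compl_le_induce [DecidableEq V] (v : V) (hH : (G.induce {v}ᶜ).Connected) :
    ∑ a : {a : V // a ≠ v}, ∑ b : {b : V // b ≠ v}, G.dist a b ≤
      ∑ a : ({v}ᶜ : Set V), ∑ b : ({v}ᶜ : Set V), (G.induce {v}ᶜ).dist a b := by
  let e : {a : V // a ≠ v} ≃ ({v}ᶜ : Set V) := Equiv.subtypeEquivRight (by simp)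
  rw [← e.sum_comp]
  refine Finset.sum_le_sum fun a _ => ?_
  rw [← e.sum_comp]
  refine Finset.sum_le_sum fun b _ => ?_
  obtain ⟨p, hp⟩ := hH.exists_walk_length_eq_dist (e a) (e b)
  rw [← hp, ← SimpleGraph.Walk.length_map (SimpleGraph.Embedding.induce {v}ᶜ).toHom p]
  exact SimpleGraph.dist_le _

/-- The Wiener index of a connected graph is at most that of a path, by removing vertices that do
not disconnect the graph. -/
theorem three_mul_sum_dist_add_card_le (hG : G.Connected) :
    3 * ∑ a, ∑ b, G.dist a b + Fintype.card V ≤ Fintype.card V ^ 3 := by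
  classical
  suffices h : ∀ (m : ℕ) (V : Type v) [Fintype V] (G : SimpleGraph V), Fintype.card V = m + 1 →
      G.Connected → 3 * ∑ a, ∑ b, G.dist a b + Fintype.card V ≤ Fintype.card V ^ 3 by
    have := hG.nonempty
    exact h (Fintype.card V - 1) V G (Nat.succ_pred_eq_of_pos Fintype.card_pos).symm hG
  intro m
  induction m with
  | zero =>
    intro V _ G hV hG
    have : Subsingleton V := Fintype.card_le_one_iff_subsingleton.1 hV.le
    have h0 : ∀ a b, G.dist a b = 0 := fun a b => by rw [Subsingleton.elim a b]; simp
    simp [h0, hV]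
  | succ m ih =>
    intro V _ G hV hG
    have : Nontrivial V := Fintype.one_lt_card_iff_nontrivial.1 (by omega)
    obtain ⟨v, hv⟩ := hG.exists_connected_induce_compl_singleton_of_finite_nontrivial
    have hcard : Fintype.card ({v}ᶜ : Set V) = m + 1 := by
      rw [Fintype.card_compl_set]; simp [hV]
    have h1 := ih _ _ hcard hv
    have h2 := sum_dist_compl_le_induce v hv
    have h3 := two_mul_sum_dist_add_card_le hG v
    rw [sum_sum_dist_split v, hV]
    rw [hcard] at h1
    rw [hV] at h3
    nlinarith

/-- Only the path attains the maximal Wiener index: equality forces maximal distance sums at the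
removed vertex, so that all distances from it differ. -/
theorem nonempty_iso_pathGraph_of_sum_dist (hG : G.Connected)
    (h : Fintype.card V ^ 3 ≤ 3 * ∑ a, ∑ b, G.dist a b + Fintype.card V) :
    Nonempty (G ≃g SimpleGraph.pathGraph (Fintype.card V)) := by
  classical
  have hne := hG.nonempty
  rcases subsingleton_or_nontrivial V with hs | hn
  · exact nonempty_iso_pathGraph_of_injective_dist hG hne.some fun a b _ => Subsingleton.elim a b
  obtain ⟨v, hv⟩ := hG.exists_connected_induce_compl_singleton_of_finite_nontrivial
  obtain ⟨m, hm⟩ : ∃ m, Fintype.card V = m + 1 :=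
    ⟨_, (Nat.succ_pred_eq_of_pos Fintype.card_pos).symm⟩
  have hcard : Fintype.card ({v}ᶜ : Set V) = m := by
    rw [Fintype.card_compl_set]; simp [hm]
  have h1 := three_mul_sum_dist_add_card_le hv
  have h2 := sum_dist_compl_le_induce v hv
  have h3 := two_mul_sum_add_card_eq_le (G.dist v) (exists_dist_eq_of_lt hG v)
  refine nonempty_iso_pathGraph_of_injective_dist hG v
    (injective_of_card_filter_eq_le _ ?_)
  rw [sum_sum_dist_split v] at h
  rw [hcard] at h1
  rw [hm] at h h3 ⊢
  nlinarith

theorem three_mul_sum_abs_sub (n : ℕ) :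
    3 * ∑ a : Fin n, ∑ b : Fin n, |((a : ℕ) : ℝ) - (b : ℕ)| = (n : ℝ) ^ 3 - n := by
  have hrow : ∀ m : ℕ, 2 * ∑ b ∈ Finset.range m, ((m : ℝ) - b) = m * (m + 1) := by
    intro m
    rw [Finset.sum_sub_distrib]
    induction m with
    | zero => simp
    | succ m ih =>
      rw [Finset.sum_range_succ (fun b : ℕ => (b : ℝ))]
      simp only [Finset.sum_const, Finset.card_range, nsmul_eq_mul] at ih ⊢
      push_cast
      linarith
  induction n with
  | zero => simp
  | succ n ih =>
    simp only [Fin.sum_univ_castSucc, Finset.sum_add_distrib, Fin.val_castSucc, Fin.val_last,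
      sub_self, abs_zero, add_zero]
    have h1 : ∑ a : Fin n, |((a : ℕ) : ℝ) - (n : ℕ)| = ∑ b ∈ Finset.range n, ((n : ℝ) - b) := by
      rw [Fin.sum_univ_eq_sum_range (fun a => |(a : ℝ) - (n : ℕ)|)]
      refine Finset.sum_congr rfl fun a ha => ?_
      have : (a : ℝ) ≤ n := by exact_mod_cast (Finset.mem_range.1 ha).le
      rw [abs_sub_comm, abs_of_nonneg (by linarith)]
    have h2 : ∑ a : Fin n, |((n : ℕ) : ℝ) - (a : ℕ)| = ∑ b ∈ Finset.range n, ((n : ℝ) - b) := by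
      rw [← h1]; exact Finset.sum_congr rfl fun a _ => abs_sub_comm _ _
    rw [h1, h2]
    have := hrow n
    push_cast
    linarith

end Combinatorics

/-! ### Spectral decomposition of the Laplacian -/

section Spectral

open Matrix

variable {V : Type v} [Fintype V] [DecidableEq V] (G : SimpleGraph V) [DecidableRel G.Adj]

/-- The Laplacian eigenvalues indexed by the vertices, in the enumeration that matches
`lapEigenvector`. -/
noncomputable def lapEigenvalueAt (k : V) : ℝ :=
  (G.isHermitian_lapMatrix (R := ℝ)).eigenvalues k

/-- An orthonormal basis of Laplacian eigenvectors, as plain functions. -/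
noncomputable def lapEigenvector (k : V) : V → ℝ :=
  ⇑((G.isHermitian_lapMatrix (R := ℝ)).eigenvectorBasis k)

theorem lapMatrix_mulVec_lapEigenvector (k : V) :
    G.lapMatrix ℝ *ᵥ lapEigenvector G k = lapEigenvalueAt G k • lapEigenvector G k :=
  (G.isHermitian_lapMatrix (R := ℝ)).mulVec_eigenvectorBasis k

theorem lapEigenvector_dotProduct_mulVec (k : V) (x : V → ℝ) :
    lapEigenvector G k ⬝ᵥ (G.lapMatrix ℝ *ᵥ x) =
      lapEigenvalueAt G k * (lapEigenvector G k ⬝ᵥ x) := by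
  rw [dotProduct_mulVec, ← mulVec_transpose, (G.isSymm_lapMatrix (R := ℝ)).eq,
    lapMatrix_mulVec_lapEigenvector, smul_dotProduct, smul_eq_mul]

theorem dotProduct_eq_sum_lapEigenvector (x y : V → ℝ) :
    x ⬝ᵥ y = ∑ k, (lapEigenvector G k ⬝ᵥ x) * (lapEigenvector G k ⬝ᵥ y) := by
  have h := (G.isHermitian_lapMatrix (R := ℝ)).eigenvectorBasis.sum_inner_mul_inner
    (WithLp.toLp 2 x) (WithLp.toLp 2 y)
  simp only [EuclideanSpace.inner_eq_star_dotProduct, star_trivial] at h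
  rw [dotProduct_comm, ← h]
  refine Finset.sum_congr rfl fun k _ => ?_
  rw [dotProduct_comm y]
  rfl

theorem lapEigenvector_dotProduct_lapEigenvector (k l : V) :
    lapEigenvector G k ⬝ᵥ lapEigenvector G l = if k = l then 1 else 0 := by
  have h := orthonormal_iff_ite.1
    (G.isHermitian_lapMatrix (R := ℝ)).eigenvectorBasis.orthonormal k l
  rw [EuclideanSpace.inner_eq_star_dotProduct, star_trivial, dotProduct_comm] at h
  exact h

theorem eq_sum_lapEigenvector (x : V → ℝ) (i : V) :
    x i = ∑ k, (lapEigenvector G k ⬝ᵥ x) * lapEigenvector G k i := by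
  have h := dotProduct_eq_sum_lapEigenvector G x (Pi.single i 1)
  simpa using h

theorem lapEigenvalueAt_nonneg (k : V) : 0 ≤ lapEigenvalueAt G k :=
  (G.posSemidef_lapMatrix ℝ).eigenvalues_nonneg k

theorem dotProduct_lapMatrix_eq_sum (x : V → ℝ) :
    x ⬝ᵥ (G.lapMatrix ℝ *ᵥ x) =
      ∑ k, lapEigenvalueAt G k * (lapEigenvector G k ⬝ᵥ x) ^ 2 := by
  rw [dotProduct_eq_sum_lapEigenvector G]
  refine Finset.sum_congr rfl fun k _ => ?_
  rw [lapEigenvector_dotProduct_mulVec]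
  ring

theorem dotProduct_lapMatrix_eq_sum_adj (x : V → ℝ) :
    x ⬝ᵥ (G.lapMatrix ℝ *ᵥ x) =
      (∑ i, ∑ j, if G.Adj i j then (x i - x j) ^ 2 else 0) / 2 := by
  rw [← toLinearMap₂'_apply', SimpleGraph.lapMatrix_toLinearMap₂']

theorem sum_lapEigenvector_eq_zero {k : V} (hk : lapEigenvalueAt G k ≠ 0) :
    ∑ i, lapEigenvector G k i = 0 := by
  have h := lapEigenvector_dotProduct_mulVec G k (fun _ => 1)
  rw [G.lapMatrix_mulVec_const_eq_zero, dotProduct_zero] at h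
  simpa [dotProduct] using (mul_eq_zero.1 h.symm).resolve_left hk

variable {G}

theorem lapEigenvector_const (hG : G.Connected) {k : V} (hk : lapEigenvalueAt G k = 0) (i j : V) :
    lapEigenvector G k i = lapEigenvector G k j := by
  have h := lapMatrix_mulVec_lapEigenvector G k
  rw [hk, zero_smul] at h
  exact G.lapMatrix_mulVec_eq_zero_iff_forall_reachable.1 h i j (hG.preconnected i j)

theorem centeringMatrix_mulVec_apply (x : V → ℝ) (i : V) :
    (centeringMatrix V *ᵥ x) i = x i - (∑ j, x j) / Fintype.card V := by
  rw [centeringMatrix, sub_mulVec, one_mulVec, smul_mulVec]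
  simp only [Pi.sub_apply, Pi.smul_apply, smul_eq_mul, mulVec, dotProduct, of_apply, one_mul]
  ring

omit [DecidableEq V] in
theorem sum_sum_sq_sub (f : V → ℝ) :
    ∑ i, ∑ j, (f i - f j) ^ 2 = 2 * (Fintype.card V * (f ⬝ᵥ f) - (∑ i, f i) ^ 2) := by
  have hexp : ∀ i j, (f i - f j) ^ 2 = f i * f i - 2 * (f i * f j) + f j * f j :=
    fun i j => by ring
  simp only [hexp, Finset.sum_add_distrib, Finset.sum_sub_distrib, Finset.sum_const, nsmul_eq_mul,
    Finset.card_univ, dotProduct]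
  simp only [← Finset.mul_sum, ← Finset.sum_mul]
  ring

/-- The centering matrix is the projection onto the eigenvectors with nonzero eigenvalue. -/
theorem dotProduct_centeringMatrix (hG : G.Connected) (x : V → ℝ) :
    x ⬝ᵥ (centeringMatrix V *ᵥ x) =
      ∑ k with lapEigenvalueAt G k ≠ 0, (lapEigenvector G k ⬝ᵥ x) ^ 2 := by
  have := hG.nonempty
  rw [dotProduct_eq_sum_lapEigenvector G, Finset.sum_filter]
  refine Finset.sum_congr rfl fun k _ => ?_
  have hexp : lapEigenvector G k ⬝ᵥ (centeringMatrix V *ᵥ x) = lapEigenvector G k ⬝ᵥ x -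
      (∑ i, lapEigenvector G k i) * ((∑ j, x j) / Fintype.card V) := by
    simp only [dotProduct, centeringMatrix_mulVec_apply, mul_sub, Finset.sum_sub_distrib,
      Finset.sum_mul]
  rw [hexp]
  split_ifs with hk
  · rw [sum_lapEigenvector_eq_zero G hk]; ring
  · rw [not_not] at hk
    have hc := lapEigenvector_const hG hk
    obtain ⟨i₀⟩ := hG.nonempty
    have hcard : (Fintype.card V : ℝ) ≠ 0 := by exact_mod_cast Fintype.card_ne_zero
    simp only [dotProduct, fun i => hc i i₀, ← Finset.mul_sum, Finset.sum_const,
      Finset.card_univ, nsmul_eq_mul]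
    field_simp
    ring

theorem card_lapEigenvalueAt_ne_zero (hG : G.Connected) :
    ((Finset.univ.filter fun k => lapEigenvalueAt G k ≠ 0).card : ℝ) = Fintype.card V - 1 := by
  have := hG.nonempty
  have hcard : (Fintype.card V : ℝ) ≠ 0 := by exact_mod_cast Fintype.card_ne_zero
  have h1 : ∑ i, Pi.single i (1 : ℝ) ⬝ᵥ (centeringMatrix V *ᵥ Pi.single i 1) =
      (Fintype.card V : ℝ) - 1 := by
    have h : ∀ i, Pi.single i (1 : ℝ) ⬝ᵥ (centeringMatrix V *ᵥ Pi.single i 1) =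
        1 - 1 / Fintype.card V := fun i => by
      rw [single_one_dotProduct, centeringMatrix_mulVec_apply]; simp
    simp only [h, Finset.sum_const, Finset.card_univ, nsmul_eq_mul]
    field_simp
  rw [← h1]
  simp only [dotProduct_centeringMatrix hG]
  rw [Finset.sum_comm, Finset.card_eq_sum_ones, Nat.cast_sum]
  refine Finset.sum_congr rfl fun k _ => ?_
  have h := lapEigenvector_dotProduct_lapEigenvector G k k
  simp only [dotProduct, if_true] at h
  simpa [sq] using h.symm

theorem sum_lapEigenvalueAt : ∑ k, lapEigenvalueAt G k = ∑ v, (G.degree v : ℝ) := by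
  have h := (G.isHermitian_lapMatrix (R := ℝ)).trace_eq_sum_eigenvalues
  simp only [RCLike.ofReal_real_eq_id, id] at h
  rw [show ∑ k, lapEigenvalueAt G k = (G.lapMatrix ℝ).trace from h.symm]
  simp [Matrix.trace, SimpleGraph.lapMatrix, SimpleGraph.degMatrix]

/-- As `0⁻¹ = 0`, the one zero eigenvalue contributes nothing to the sum over all of them. -/
theorem rhoSS_eq_sum (hG : G.Connected) :
    rhoSS G = (1 / 2) * ∑ k, (lapEigenvalueAt G k)⁻¹ := by
  have := hG.nonempty
  let hA := G.isHermitian_lapMatrix (R := ℝ)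
  let e : Fin (Fintype.card V) ≃ V := Fintype.equivOfCardEq (Fintype.card_fin _)
  have hall : ∑ i, (lapEigenvalue G i)⁻¹ = ∑ k, (lapEigenvalueAt G k)⁻¹ := by
    rw [← (Fin.revPerm.trans e).sum_comp]
    refine Finset.sum_congr rfl fun i _ => ?_
    simp [lapEigenvalue, lapEigenvalueAt, Matrix.IsHermitian.eigenvalues, e]
  have hpos : 0 < Fintype.card V := Fintype.card_pos
  have hmin : lapEigenvalue G ⟨0, hpos⟩ = 0 := by
    have hdet := hA.det_eq_prod_eigenvalues
    rw [G.det_lapMatrix_eq_zero] at hdet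
    obtain ⟨k, -, hk⟩ := Finset.prod_eq_zero_iff.1 hdet.symm
    have hk' : hA.eigenvalues₀ (e.symm k) = 0 := hk
    have hle : lapEigenvalue G ⟨0, hpos⟩ ≤ 0 := by
      rw [← hk']
      exact hA.eigenvalues₀_antitone (Fin.le_def.2 (by simp [Fin.val_rev]; omega))
    have hge : 0 ≤ lapEigenvalue G ⟨0, hpos⟩ := by
      have := lapEigenvalueAt_nonneg G (e (Fin.rev ⟨0, hpos⟩))
      simpa [lapEigenvalue, lapEigenvalueAt, Matrix.IsHermitian.eigenvalues, e] using this
    exact le_antisymm hle hge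
  rw [rhoSS, ← hall, Finset.sum_filter]
  congr 1
  refine Finset.sum_congr rfl fun i _ => ?_
  split_ifs with hi
  · rfl
  · have : i = ⟨0, hpos⟩ := Fin.ext (by simpa using hi)
    rw [this, hmin, _root_.inv_zero]

/-! ### The lower bound and the complete graph -/

omit [DecidableEq V] in
theorem degree_le_card_sub_one (v : V) : (G.degree v : ℝ) ≤ Fintype.card V - 1 := by
  have h : G.degree v + 1 ≤ Fintype.card V := G.degree_lt_card_verts v
  have : (G.degree v : ℝ) + 1 ≤ Fintype.card V := by exact_mod_cast h
  linarith

omit [DecidableEq V] in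
theorem sum_degree_le : ∑ v, (G.degree v : ℝ) ≤ Fintype.card V * (Fintype.card V - 1) := by
  refine (Finset.sum_le_sum fun v (_ : v ∈ Finset.univ) => degree_le_card_sub_one v).trans_eq ?_
  rw [Finset.sum_const, nsmul_eq_mul, Finset.card_univ]

theorem eq_top_of_le_sum_degree
    (h : (Fintype.card V : ℝ) * (Fintype.card V - 1) ≤ ∑ v, (G.degree v : ℝ)) : G = ⊤ := by
  have hle : ∀ v ∈ Finset.univ, (G.degree v : ℝ) ≤ Fintype.card V - 1 :=
    fun v _ => degree_le_card_sub_one v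
  have heq := (Finset.sum_eq_sum_iff_of_le hle).1
    (le_antisymm (Finset.sum_le_sum hle)
      (by rwa [Finset.sum_const, nsmul_eq_mul, Finset.card_univ]))
  ext a b
  refine ⟨fun hab => hab.ne, fun hab => ?_⟩
  have hd : G.degree a + 1 = Fintype.card V := by
    have := heq a (Finset.mem_univ a)
    have : (G.degree a : ℝ) + 1 = Fintype.card V := by linarith
    exact_mod_cast this
  have hsub : G.neighborFinset a ⊆ Finset.univ.erase a := fun w hw => by
    simpa using ((G.mem_neighborFinset a w).1 hw).ne'
  have hfin := Finset.eq_of_subset_of_card_le hsub (by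
    rw [Finset.card_erase_of_mem (Finset.mem_univ a), Finset.card_univ,
      SimpleGraph.card_neighborFinset_eq_degree]
    omega)
  rw [← SimpleGraph.mem_neighborFinset, hfin]
  simpa using hab.symm

/-- The tangent line of `1 / μ` at `μ = n` bounds the sum of the inverse eigenvalues by the
trace of the Laplacian. -/
theorem le_sum_inv_lapEigenvalueAt (hG : G.Connected) :
    2 * ((Fintype.card V : ℝ) - 1) / Fintype.card V -
      (∑ v, (G.degree v : ℝ)) / (Fintype.card V : ℝ) ^ 2 ≤ ∑ k, (lapEigenvalueAt G k)⁻¹ := by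
  have := hG.nonempty
  have hn : (0 : ℝ) < Fintype.card V := by exact_mod_cast Fintype.card_pos
  obtain ⟨n, hn_def⟩ : ∃ n : ℝ, n = Fintype.card V := ⟨_, rfl⟩
  rw [← hn_def] at hn ⊢
  have key : ∀ k, (if lapEigenvalueAt G k ≠ 0 then 2 / n else 0) - lapEigenvalueAt G k / n ^ 2
      ≤ (lapEigenvalueAt G k)⁻¹ := by
    intro k
    split_ifs with hk
    · have hpos : 0 < lapEigenvalueAt G k := (lapEigenvalueAt_nonneg G k).lt_of_ne' hk
      have : (lapEigenvalueAt G k)⁻¹ - (2 / n - lapEigenvalueAt G k / n ^ 2) =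
          (n - lapEigenvalueAt G k) ^ 2 / (lapEigenvalueAt G k * n ^ 2) := by
        field_simp
        ring
      have h0 : 0 ≤ (n - lapEigenvalueAt G k) ^ 2 / (lapEigenvalueAt G k * n ^ 2) := by positivity
      linarith
    · rw [not_not] at hk
      simp [hk]
  have hsum := Finset.sum_le_sum fun k (_ : k ∈ Finset.univ) => key k
  rw [Finset.sum_sub_distrib, ← Finset.sum_filter, Finset.sum_const, nsmul_eq_mul,
    card_lapEigenvalueAt_ne_zero hG, ← hn_def, ← Finset.sum_div, sum_lapEigenvalueAt] at hsum
  refine le_trans (le_of_eq ?_) hsum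
  ring

theorem sum_inv_lapEigenvalueAt_of_eq_top (hG : G.Connected) (h : G = ⊤) :
    ∑ k, (lapEigenvalueAt G k)⁻¹ = ((Fintype.card V : ℝ) - 1) / Fintype.card V := by
  have hval : ∀ k, lapEigenvalueAt G k ≠ 0 → lapEigenvalueAt G k = Fintype.card V := by
    intro k hk
    have hq := dotProduct_lapMatrix_eq_sum_adj G (lapEigenvector G k)
    have hn := lapEigenvector_dotProduct_lapEigenvector G k k
    have hs := sum_lapEigenvector_eq_zero G hk
    rw [if_pos rfl] at hn
    rw [lapMatrix_mulVec_lapEigenvector, dotProduct_smul, hn, smul_eq_mul, mul_one] at hq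
    rw [hq]
    have hexp : ∀ i j, (if G.Adj i j then (lapEigenvector G k i - lapEigenvector G k j) ^ 2 else 0)
        = (lapEigenvector G k i - lapEigenvector G k j) ^ 2 := by
      intro i j
      by_cases hij : i = j
      · simp [hij]
      · rw [if_pos (by rw [h]; exact hij)]
    simp only [hexp, sum_sum_sq_sub, hn, hs]
    ring
  have hterm : ∀ k, (lapEigenvalueAt G k)⁻¹ =
      if lapEigenvalueAt G k ≠ 0 then (Fintype.card V : ℝ)⁻¹ else 0 := by
    intro k
    split_ifs with hk
    · rw [hval k hk]
    · rw [not_not] at hk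
      rw [hk, _root_.inv_zero]
  rw [Finset.sum_congr rfl fun k _ => hterm k, ← Finset.sum_filter, Finset.sum_const, nsmul_eq_mul,
    card_lapEigenvalueAt_ne_zero hG, div_eq_mul_inv]

/-! ### Effective resistance, the upper bound and the path graph -/

variable (G) in
/-- The effective resistance between two vertices, through the spectral decomposition of the
pseudo-inverse of the Laplacian; the kernel drops out as `x / 0 = 0`. -/
noncomputable def effResistance (i j : V) : ℝ :=
  ∑ k, (lapEigenvector G k i - lapEigenvector G k j) ^ 2 / lapEigenvalueAt G k

theorem effResistance_nonneg (i j : V) : 0 ≤ effResistance G i j :=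
  Finset.sum_nonneg fun k _ => div_nonneg (sq_nonneg _) (lapEigenvalueAt_nonneg G k)

theorem sum_effResistance :
    ∑ i, ∑ j, effResistance G i j = 2 * Fintype.card V * ∑ k, (lapEigenvalueAt G k)⁻¹ := by
  simp only [effResistance]
  rw [Finset.sum_congr rfl fun i _ => Finset.sum_comm, Finset.sum_comm, Finset.mul_sum]
  refine Finset.sum_congr rfl fun k _ => ?_
  simp only [← Finset.sum_div]
  by_cases hk : lapEigenvalueAt G k = 0
  · simp [hk]
  have hn := lapEigenvector_dotProduct_lapEigenvector G k k
  rw [if_pos rfl] at hn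
  rw [sum_sum_sq_sub, hn, sum_lapEigenvector_eq_zero G hk]
  ring

/-- The Dirichlet principle: a potential of energy `E` has potential differences at most
`√(E R)`. -/
theorem sq_sub_le_energy_mul_effResistance (hG : G.Connected) (g : V → ℝ) (i j : V) :
    (g i - g j) ^ 2 ≤ (g ⬝ᵥ (G.lapMatrix ℝ *ᵥ g)) * effResistance G i j := by
  have hdiff : g i - g j = ∑ k, (lapEigenvector G k ⬝ᵥ g) *
      (lapEigenvector G k i - lapEigenvector G k j) := by
    rw [eq_sum_lapEigenvector G g i, eq_sum_lapEigenvector G g j, ← Finset.sum_sub_distrib]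
    exact Finset.sum_congr rfl fun k _ => by ring
  rw [hdiff, dotProduct_lapMatrix_eq_sum, effResistance]
  refine Finset.sum_sq_le_sum_mul_sum_of_sq_le_mul _
    (fun k _ => mul_nonneg (lapEigenvalueAt_nonneg G k) (sq_nonneg _))
    (fun k _ => div_nonneg (sq_nonneg _) (lapEigenvalueAt_nonneg G k)) fun k _ => ?_
  by_cases hk : lapEigenvalueAt G k = 0
  · rw [lapEigenvector_const hG hk i j]; simp
  · exact le_of_eq (by field_simp)

/-- The energy of a potential on the subgraph induced by `S`, each edge counted twice. -/
def energyOn (G : SimpleGraph V) [DecidableRel G.Adj] (g : V → ℝ) (S : Finset V) : ℝ :=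
  ∑ a ∈ S, ∑ b ∈ S, if G.Adj a b then (g a - g b) ^ 2 else 0

omit [Fintype V] [DecidableEq V] in
theorem energyOn_nonneg (g : V → ℝ) (S : Finset V) : 0 ≤ energyOn G g S :=
  Finset.sum_nonneg fun a _ => Finset.sum_nonneg fun b _ => by split_ifs <;> positivity

omit [Fintype V] in
theorem energyOn_add_le_insert (g : V → ℝ) {S : Finset V} {i w : V} (hi : i ∉ S) (hw : w ∈ S)
    (hadj : G.Adj i w) : energyOn G g S + 2 * (g i - g w) ^ 2 ≤ energyOn G g (insert i S) := by
  have hnn : ∀ a b, 0 ≤ if G.Adj a b then (g a - g b) ^ 2 else 0 := fun a b => by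
    split_ifs <;> positivity
  have h1 : (g i - g w) ^ 2 ≤ ∑ b ∈ S, if G.Adj i b then (g i - g b) ^ 2 else 0 := by
    refine le_trans (le_of_eq ?_) (Finset.single_le_sum (fun b _ => hnn i b) hw)
    rw [if_pos hadj]
  have h2 : (g i - g w) ^ 2 ≤ ∑ a ∈ S, if G.Adj a i then (g a - g i) ^ 2 else 0 := by
    refine le_trans (le_of_eq ?_) (Finset.single_le_sum (fun a _ => hnn a i) hw)
    rw [if_pos hadj.symm]
    ring
  simp only [energyOn, Finset.sum_insert hi, Finset.sum_add_distrib]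
  have h3 := hnn i i
  linarith

omit [Fintype V] in
/-- Along a path, the potential drop is controlled by the length of the path and the energy on its
vertices, by the Cauchy–Schwarz inequality. -/
theorem two_mul_sq_sub_le_length_mul_energyOn (g : V → ℝ) {i j : V} (p : G.Walk i j)
    (hp : p.IsPath) :
    2 * (g i - g j) ^ 2 ≤ p.length * energyOn G g p.support.toFinset := by
  induction p with
  | nil => simp
  | @cons i w j hadj q ih =>
    rw [SimpleGraph.Walk.cons_isPath_iff] at hp
    have hq := ih hp.1
    have hins := energyOn_add_le_insert g (S := q.support.toFinset) (by simpa using hp.2)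
      (by simp) hadj
    rw [SimpleGraph.Walk.support_cons, List.toFinset_cons, SimpleGraph.Walk.length_cons]
    have hE := energyOn_nonneg (G := G) g q.support.toFinset
    have hl : (0 : ℝ) ≤ q.length := Nat.cast_nonneg _
    push_cast
    generalize energyOn G g q.support.toFinset = E at *
    generalize (q.length : ℝ) = l at *
    obtain ⟨x, hx⟩ : ∃ x, x = g i - g w := ⟨_, rfl⟩
    obtain ⟨y, hy⟩ : ∃ y, y = g w - g j := ⟨_, rfl⟩
    rw [← hx] at hins
    rw [← hy] at hq
    rw [show g i - g j = x + y by rw [hx, hy]; ring]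
    have hmain : 4 * (x * y) ≤ 2 * l * x ^ 2 + E := by
      rcases hl.eq_or_lt with h0 | h0
      · have : y = 0 := by
          rw [← h0, zero_mul] at hq
          exact pow_eq_zero_iff two_ne_zero |>.1 (le_antisymm (by linarith) (sq_nonneg y))
        rw [this, ← h0]
        linarith
      · refine le_of_mul_le_mul_left ?_ h0
        nlinarith [sq_nonneg (l * x - y)]
    calc 2 * (x + y) ^ 2 ≤ (l + 1) * (E + 2 * x ^ 2) := by nlinarith
      _ ≤ _ := mul_le_mul_of_nonneg_left hins (by linarith)

theorem sq_sub_le_length_mul_energy (g : V → ℝ) {i j : V} (p : G.Walk i j) (hp : p.IsPath) :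
    (g i - g j) ^ 2 ≤ p.length * (g ⬝ᵥ (G.lapMatrix ℝ *ᵥ g)) := by
  have h1 := two_mul_sq_sub_le_length_mul_energyOn g p hp
  have h2 : energyOn G g p.support.toFinset ≤ energyOn G g Finset.univ := by
    have hnn : ∀ a b, 0 ≤ if G.Adj a b then (g a - g b) ^ 2 else 0 := fun a b => by
      split_ifs <;> positivity
    refine (Finset.sum_le_sum fun a _ => ?_).trans (Finset.sum_le_sum_of_subset_of_nonneg
      (Finset.subset_univ _) fun a _ _ => Finset.sum_nonneg fun b _ => hnn a b)
    exact Finset.sum_le_sum_of_subset_of_nonneg (Finset.subset_univ _) fun b _ _ => hnn a b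
  have h3 := mul_le_mul_of_nonneg_left h2 (Nat.cast_nonneg (α := ℝ) p.length)
  rw [dotProduct_lapMatrix_eq_sum_adj]
  simp only [energyOn] at h1 h3
  linarith

/-- Effective resistance is at most distance. -/
theorem effResistance_le_dist (hG : G.Connected) (i j : V) :
    effResistance G i j ≤ G.dist i j := by
  obtain ⟨p, hp, hl⟩ := hG.exists_path_of_dist i j
  -- the potential for a unit current from `i` to `j`: energy and potential drop both equal `R`
  let g : V → ℝ := fun v => ∑ l, (lapEigenvector G l i - lapEigenvector G l j) /
    lapEigenvalueAt G l * lapEigenvector G l v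
  have hcoef : ∀ k, lapEigenvector G k ⬝ᵥ g =
      (lapEigenvector G k i - lapEigenvector G k j) / lapEigenvalueAt G k := by
    intro k
    have : g = ∑ l, ((lapEigenvector G l i - lapEigenvector G l j) /
        lapEigenvalueAt G l) • lapEigenvector G l := by
      ext v; simp [g]
    rw [this, dotProduct_sum]
    simp [dotProduct_smul, lapEigenvector_dotProduct_lapEigenvector]
  have henergy : g ⬝ᵥ (G.lapMatrix ℝ *ᵥ g) = effResistance G i j := by
    rw [dotProduct_lapMatrix_eq_sum, effResistance]
    refine Finset.sum_congr rfl fun k _ => ?_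
    rw [hcoef]
    by_cases hk : lapEigenvalueAt G k = 0
    · simp [hk]
    · field_simp
  have hdrop : g i - g j = effResistance G i j := by
    simp only [g, effResistance]
    rw [← Finset.sum_sub_distrib]
    exact Finset.sum_congr rfl fun k _ => by ring
  have h := sq_sub_le_length_mul_energy g p hp
  rw [hdrop, henergy, hl] at h
  rcases (effResistance_nonneg (G := G) i j).eq_or_lt with h0 | h0
  · rw [← h0]; positivity
  · nlinarith

theorem sum_pathGraph_energy_le (n : ℕ) (h : ℕ → ℝ)
    (hh : ∀ k, h k ≤ h (k + 1) ∧ h (k + 1) ≤ h k + 1) :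
    ∑ k : Fin n, ∑ l : Fin n, (if (k : ℕ) + 1 = l ∨ (l : ℕ) + 1 = k then (h k - h l) ^ 2 else 0) ≤
      2 * (h n - h 0) := by
  have hrow : ∑ k : Fin n, ∑ l : Fin n,
      (if (k : ℕ) + 1 = l then h (k + 1) - h k else 0) ≤ h n - h 0 := by
    rw [← Finset.sum_range_sub, ← Fin.sum_univ_eq_sum_range (fun k => h (k + 1) - h k)]
    refine Finset.sum_le_sum fun k _ => ?_
    have hk := sub_nonneg.2 (hh k).1
    by_cases hn : (k : ℕ) + 1 < n
    · rw [Finset.sum_eq_single (⟨k + 1, hn⟩ : Fin n)]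
      · simp
      · intro l _ hl
        exact if_neg fun h => hl (Fin.ext h.symm)
      · simp
    · rw [Finset.sum_eq_zero fun l _ => if_neg (by have := l.2; omega)]
      exact hk
  have hterm : ∀ k l : Fin n,
      (if (k : ℕ) + 1 = l ∨ (l : ℕ) + 1 = k then (h k - h l) ^ 2 else 0) ≤
        (if (k : ℕ) + 1 = l then h (k + 1) - h k else 0) +
        (if (l : ℕ) + 1 = k then h (l + 1) - h l else 0) := by
    intro k l
    by_cases h1 : (k : ℕ) + 1 = l
    · have h2 : ¬ (l : ℕ) + 1 = k := by omega
      rw [if_pos (Or.inl h1), if_pos h1, if_neg h2, ← h1]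
      nlinarith [hh k]
    · by_cases h2 : (l : ℕ) + 1 = k
      · rw [if_pos (Or.inr h2), if_neg h1, if_pos h2, ← h2]
        nlinarith [hh l]
      · simp [h1, h2]
  refine (Finset.sum_le_sum fun k _ => Finset.sum_le_sum fun l _ => hterm k l).trans ?_
  simp only [Finset.sum_add_distrib]
  rw [Finset.sum_comm (f := fun k l : Fin n => if (l : ℕ) + 1 = k then h (l + 1) - h l else 0)]
  linarith

/-- On a path, effective resistance is at least distance: test the Dirichlet principle with the
position along the path, clamped to the segment between the two vertices. -/
theorem abs_sub_le_effResistance_of_iso (hG : G.Connected) {n : ℕ}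
    (φ : G ≃g SimpleGraph.pathGraph n) (i j : V) :
    |((φ i : ℕ) : ℝ) - (φ j : ℕ)| ≤ effResistance G i j := by
  wlog hij : (φ i : ℕ) ≤ φ j generalizing i j
  · have := this j i (not_le.1 hij).le
    rw [abs_sub_comm]
    simpa only [effResistance, sub_sq_comm] using this
  have hij' : ((φ i : ℕ) : ℝ) ≤ (φ j : ℕ) := by exact_mod_cast hij
  let h : ℕ → ℝ := fun k => max (φ i : ℕ) (min (φ j : ℕ) k)
  have hmono : ∀ k, h k ≤ h (k + 1) ∧ h (k + 1) ≤ h k + 1 := by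
    intro k
    simp only [h]
    push_cast
    constructor <;> simp only [max_def, min_def] <;> split_ifs <;> linarith
  have henergy : (fun v => h (φ v)) ⬝ᵥ (G.lapMatrix ℝ *ᵥ fun v => h (φ v)) ≤
      ((φ j : ℕ) : ℝ) - (φ i : ℕ) := by
    rw [dotProduct_lapMatrix_eq_sum_adj]
    have hE := sum_pathGraph_energy_le n h hmono
    have h1 : h n ≤ (φ j : ℕ) := max_le hij' (min_le_left _ _)
    have h0 : ((φ i : ℕ) : ℝ) ≤ h 0 := le_max_left _ _
    have hE' : (∑ a, ∑ b, if G.Adj a b then (h (φ a) - h (φ b)) ^ 2 else 0) ≤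
        2 * (h n - h 0) := by
      refine le_trans (le_of_eq ?_) hE
      rw [← φ.toEquiv.sum_comp]
      refine Finset.sum_congr rfl fun a _ => ?_
      rw [← φ.toEquiv.sum_comp]
      refine Finset.sum_congr rfl fun b _ => ?_
      exact if_congr (φ.map_adj_iff.symm.trans SimpleGraph.pathGraph_adj) rfl rfl
    linarith
  have hdir := sq_sub_le_energy_mul_effResistance hG (fun v => h (φ v)) i j
  have hi : h (φ i) = (φ i : ℕ) := by simp [h, hij']
  have hj : h (φ j) = (φ j : ℕ) := by simp [h, hij']
  simp only [hi, hj] at hdir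
  have hR := effResistance_nonneg (G := G) i j
  have hle := mul_le_mul_of_nonneg_right henergy hR
  rw [abs_sub_comm, abs_of_nonneg (sub_nonneg.2 hij')]
  rcases (sub_nonneg.2 hij').eq_or_lt with h0 | h0
  · rwa [← h0]
  · exact le_of_mul_le_mul_left (by nlinarith) h0

theorem sum_inv_lapEigenvalueAt_le (hG : G.Connected) :
    2 * Fintype.card V * ∑ k, (lapEigenvalueAt G k)⁻¹ ≤
      ((∑ a, ∑ b, G.dist a b : ℕ) : ℝ) := by
  rw [← sum_effResistance]
  push_cast
  exact Finset.sum_le_sum fun a _ => Finset.sum_le_sum fun b _ => effResistance_le_dist hG a b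

theorem le_sum_inv_lapEigenvalueAt_of_iso (hG : G.Connected) {n : ℕ}
    (φ : G ≃g SimpleGraph.pathGraph n) :
    (n : ℝ) ^ 3 - n ≤ 3 * (2 * Fintype.card V * ∑ k, (lapEigenvalueAt G k)⁻¹) := by
  rw [← sum_effResistance, ← three_mul_sum_abs_sub]
  have hsum : ∑ a : Fin n, ∑ b : Fin n, |((a : ℕ) : ℝ) - (b : ℕ)| =
      ∑ i, ∑ j, |((φ i : ℕ) : ℝ) - (φ j : ℕ)| := by
    rw [← φ.toEquiv.sum_comp]
    refine Finset.sum_congr rfl fun i _ => ?_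
    rw [← φ.toEquiv.sum_comp]
    rfl
  rw [hsum]
  have := Finset.sum_le_sum fun i (_ : i ∈ Finset.univ) => Finset.sum_le_sum
    fun j (_ : j ∈ Finset.univ) => abs_sub_le_effResistance_of_iso hG φ i j
  linarith

/-! ### Bounds on the performance measure -/

theorem rhoSS_ge (hG : G.Connected) :
    1 / 2 - 1 / (2 * (Fintype.card V : ℝ)) ≤ rhoSS G := by
  have := hG.nonempty
  have hn : (0 : ℝ) < Fintype.card V := by exact_mod_cast Fintype.card_pos
  have h1 := le_sum_inv_lapEigenvalueAt hG
  have h2 := div_le_div_of_nonneg_right (sum_degree_le (G := G)) (sq_nonneg (Fintype.card V : ℝ))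
  rw [rhoSS_eq_sum hG]
  have h3 : 2 * ((Fintype.card V : ℝ) - 1) / Fintype.card V -
      Fintype.card V * (Fintype.card V - 1) / (Fintype.card V : ℝ) ^ 2 =
      2 * (1 / 2 - 1 / (2 * (Fintype.card V : ℝ))) := by
    field_simp
    ring
  linarith

theorem rhoSS_eq_lower_iff (hG : G.Connected) :
    rhoSS G = 1 / 2 - 1 / (2 * (Fintype.card V : ℝ)) ↔ G = ⊤ := by
  have := hG.nonempty
  have hn : (0 : ℝ) < Fintype.card V := by exact_mod_cast Fintype.card_pos
  rw [rhoSS_eq_sum hG]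
  constructor
  · intro h
    refine eq_top_of_le_sum_degree ?_
    have h1 := le_sum_inv_lapEigenvalueAt hG
    have h3 : 2 * ((Fintype.card V : ℝ) - 1) / Fintype.card V -
        Fintype.card V * (Fintype.card V - 1) / (Fintype.card V : ℝ) ^ 2 =
        2 * (1 / 2 - 1 / (2 * (Fintype.card V : ℝ))) := by
      field_simp
      ring
    refine (div_le_div_iff_of_pos_right (pow_pos hn 2)).1 ?_
    linarith
  · intro h
    rw [sum_inv_lapEigenvalueAt_of_eq_top hG h]
    field_simp

theorem rhoSS_le (hG : G.Connected) : rhoSS G ≤ ((Fintype.card V : ℝ) ^ 2 - 1) / 12 := by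
  have := hG.nonempty
  have hn : (0 : ℝ) < Fintype.card V := by exact_mod_cast Fintype.card_pos
  have h1 := sum_inv_lapEigenvalueAt_le hG
  have h2 : (3 * ((∑ a, ∑ b, G.dist a b : ℕ) : ℝ) + Fintype.card V) ≤ (Fintype.card V : ℝ) ^ 3 := by
    exact_mod_cast three_mul_sum_dist_add_card_le hG
  rw [rhoSS_eq_sum hG]
  refine le_of_mul_le_mul_left ?_ hn
  nlinarith

theorem rhoSS_eq_upper_iff (hG : G.Connected) :
    rhoSS G = ((Fintype.card V : ℝ) ^ 2 - 1) / 12 ↔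
      Nonempty (G ≃g SimpleGraph.pathGraph (Fintype.card V)) := by
  have := hG.nonempty
  have hn : (0 : ℝ) < Fintype.card V := by exact_mod_cast Fintype.card_pos
  constructor
  · intro h
    refine nonempty_iso_pathGraph_of_sum_dist hG ?_
    have h1 := sum_inv_lapEigenvalueAt_le hG
    rw [rhoSS_eq_sum hG] at h
    have h2 : (Fintype.card V : ℝ) ^ 3 ≤
        3 * ((∑ a, ∑ b, G.dist a b : ℕ) : ℝ) + Fintype.card V := by
      have h3 := congrArg (fun r : ℝ => Fintype.card V * r) h
      linarith
    exact_mod_cast h2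
  · rintro ⟨φ⟩
    refine le_antisymm (rhoSS_le hG) ?_
    have h1 := le_sum_inv_lapEigenvalueAt_of_iso hG φ
    rw [rhoSS_eq_sum hG]
    refine le_of_mul_le_mul_left ?_ hn
    linarith

end Spectral

/-! ### The scalar Langevin equation -/

section Scalar

/-- Variation of constants for `z' = -a z + w'`, integrated by parts so that only `w` itself, which
need not be differentiable, occurs. -/
theorem eq_of_integral_equation {a : ℝ} {z w : ℝ → ℝ} (hz : ContinuousOn z (Set.Ici 0))
    (hw : Continuous w)
    (h : ∀ t, 0 ≤ t → z t = z 0 - a * (∫ s in (0 : ℝ)..t, z s) + w t) {t : ℝ} (ht : 0 ≤ t) :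
    z t = Real.exp (-(a * t)) * z 0 +
      (w t - a * ∫ s in (0 : ℝ)..t, Real.exp (-(a * (t - s))) * w s) := by
  -- `z` is only known on `[0, ∞)`, so it is extended by a constant before differentiating
  let z' : ℝ → ℝ := fun s => z (max s 0)
  have hz' : Continuous z' :=
    hz.comp_continuous (continuous_id.max continuous_const) fun s =>
      Set.mem_Ici.2 (le_max_right _ _)
  have hzz : ∀ s, 0 ≤ s → z' s = z s := fun s hs => by simp [z', hs]
  have hint : ∀ s, 0 ≤ s → ∫ r in (0 : ℝ)..s, z' r = ∫ r in (0 : ℝ)..s, z r := fun s hs =>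
    intervalIntegral.integral_congr fun r hr => by
      rw [Set.uIcc_of_le hs] at hr
      exact hzz r hr.1
  have hexp : ∀ s, HasDerivAt (fun r => Real.exp (a * r)) (a * Real.exp (a * s)) s := fun s => by
    simpa [mul_comm] using ((hasDerivAt_id s).const_mul a).exp
  have hderiv : ∀ s ∈ Set.uIcc 0 t, HasDerivAt
      (fun r => Real.exp (a * r) * ∫ q in (0 : ℝ)..r, z' q)
      (Real.exp (a * s) * z 0 + Real.exp (a * s) * w s) s := by
    intro s hs
    rw [Set.uIcc_of_le ht] at hs
    have h1 := (hexp s).mul (intervalIntegral.integral_hasDerivAt_right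
      (hz'.intervalIntegrable 0 s) (hz'.stronglyMeasurableAtFilter _ _) hz'.continuousAt)
    refine h1.congr_deriv ?_
    rw [hzz s hs.1, hint s hs.1, h s hs.1]
    ring
  have hcw : Continuous fun s => Real.exp (a * s) * w s := by fun_prop
  have hce : Continuous fun s => Real.exp (a * s) * z 0 := by fun_prop
  have hftc := intervalIntegral.integral_eq_sub_of_hasDerivAt hderiv
    ((hce.add hcw).intervalIntegrable 0 t)
  rw [intervalIntegral.integral_add (hce.intervalIntegrable 0 t) (hcw.intervalIntegrable 0 t),
    intervalIntegral.integral_mul_const] at hftc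
  have hexpint : a * ∫ s in (0 : ℝ)..t, Real.exp (a * s) = Real.exp (a * t) - 1 := by
    rw [← intervalIntegral.integral_const_mul,
      intervalIntegral.integral_eq_sub_of_hasDerivAt (fun s _ => hexp s)
        ((by fun_prop : Continuous fun s => a * Real.exp (a * s)).intervalIntegrable 0 t)]
    simp
  have hker : ∫ s in (0 : ℝ)..t, Real.exp (-(a * (t - s))) * w s =
      Real.exp (-(a * t)) * ∫ s in (0 : ℝ)..t, Real.exp (a * s) * w s := by
    rw [← intervalIntegral.integral_const_mul]
    refine intervalIntegral.integral_congr fun s _ => ?_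
    rw [← mul_assoc, ← Real.exp_add]
    congr 2
    ring
  have hinv : Real.exp (-(a * t)) * Real.exp (a * t) = 1 := by
    rw [← Real.exp_add]; simp
  rw [hker, h t ht, ← hint t ht]
  rw [intervalIntegral.integral_same, mul_zero, sub_zero] at hftc
  generalize (∫ q in (0 : ℝ)..t, z' q) = Z at *
  generalize (∫ s in (0 : ℝ)..t, Real.exp (a * s) * w s) = J at *
  have hZ : Z = Real.exp (-(a * t)) * ((∫ s in (0 : ℝ)..t, Real.exp (a * s)) * z 0 + J) := by
    rw [hftc, ← mul_assoc, hinv, one_mul]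
  rw [hZ]
  linear_combination -(Real.exp (-(a * t)) * z 0) * hexpint - z 0 * hinv

theorem sq_integral_le (t : ℝ) (ht : 0 ≤ t) {f : ℝ → ℝ} (hf : Continuous f) :
    (∫ s in (0 : ℝ)..t, f s) ^ 2 ≤ t * ∫ s in (0 : ℝ)..t, f s ^ 2 := by
  rcases ht.eq_or_lt with rfl | ht
  · simp
  set c := (∫ s in (0 : ℝ)..t, f s) / t with hc
  have hct : ∫ s in (0 : ℝ)..t, f s = c * t := by rw [hc]; field_simp
  have h0 : 0 ≤ ∫ s in (0 : ℝ)..t, (f s - c) ^ 2 :=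
    intervalIntegral.integral_nonneg ht.le fun s _ => sq_nonneg _
  have hexp : ∫ s in (0 : ℝ)..t, (f s - c) ^ 2 =
      (∫ s in (0 : ℝ)..t, f s ^ 2) - 2 * c * (∫ s in (0 : ℝ)..t, f s) + c ^ 2 * t := by
    have : ∀ s, (f s - c) ^ 2 = f s ^ 2 - 2 * c * f s + c ^ 2 := fun s => by ring
    simp only [this]
    rw [intervalIntegral.integral_add
        ((by fun_prop : Continuous fun s => f s ^ 2 - 2 * c * f s).intervalIntegrable 0 t)
        (by simp),
      intervalIntegral.integral_sub ((by fun_prop : Continuous fun s => f s ^ 2).intervalIntegrable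
        0 t) ((by fun_prop : Continuous fun s => 2 * c * f s).intervalIntegrable 0 t),
      intervalIntegral.integral_const_mul, intervalIntegral.integral_const]
    simp [mul_comm]
  rw [hexp, hct] at h0
  rw [hct]
  nlinarith

theorem hasDerivAt_exp_kernel (a t s : ℝ) :
    HasDerivAt (fun r => Real.exp (-(a * (t - r)))) (a * Real.exp (-(a * (t - s)))) s := by
  have h := ((((hasDerivAt_id s).const_sub t).const_mul a).neg).exp
  simpa [mul_comm] using h

theorem integral_exp_kernel {a : ℝ} (ha : a ≠ 0) (t p q : ℝ) :
    ∫ s in p..q, Real.exp (-(a * (t - s))) =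
      (Real.exp (-(a * (t - q))) - Real.exp (-(a * (t - p)))) / a := by
  rw [intervalIntegral.integral_eq_sub_of_hasDerivAt
    (f := fun s => Real.exp (-(a * (t - s))) / a)]
  · ring
  · intro s _
    refine ((hasDerivAt_exp_kernel a t s).div_const a).congr_deriv ?_
    field_simp
  · exact (by fun_prop : Continuous fun s => Real.exp (-(a * (t - s)))).intervalIntegrable _ _

theorem integral_exp_kernel_mul_id {a : ℝ} (ha : a ≠ 0) (t p q : ℝ) :
    ∫ s in p..q, Real.exp (-(a * (t - s))) * s =
      Real.exp (-(a * (t - q))) * (q / a - 1 / a ^ 2) -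
        Real.exp (-(a * (t - p))) * (p / a - 1 / a ^ 2) := by
  rw [intervalIntegral.integral_eq_sub_of_hasDerivAt
    (f := fun s => Real.exp (-(a * (t - s))) * (s / a - 1 / a ^ 2))]
  · intro s _
    refine ((hasDerivAt_exp_kernel a t s).mul
      (((hasDerivAt_id s).div_const a).sub_const (1 / a ^ 2))).congr_deriv ?_
    simp only [id]
    field_simp
    ring
  · exact (by fun_prop : Continuous fun s => Real.exp (-(a * (t - s))) * s).intervalIntegrable _ _

theorem integral_exp_kernel_mul_min {a : ℝ} (ha : a ≠ 0) {s t : ℝ} (hs : 0 ≤ s) (hst : s ≤ t) :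
    ∫ r in (0 : ℝ)..t, Real.exp (-(a * (t - r))) * min r s =
      s / a - (Real.exp (-(a * (t - s))) - Real.exp (-(a * t))) / a ^ 2 := by
  have hc : Continuous fun r => Real.exp (-(a * (t - r))) * min r s := by fun_prop
  rw [← intervalIntegral.integral_add_adjacent_intervals (hc.intervalIntegrable 0 s)
    (hc.intervalIntegrable s t)]
  have h1 : ∫ r in (0 : ℝ)..s, Real.exp (-(a * (t - r))) * min r s =
      ∫ r in (0 : ℝ)..s, Real.exp (-(a * (t - r))) * r :=
    intervalIntegral.integral_congr fun r hr => by
      rw [Set.uIcc_of_le hs] at hr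
      simp only [min_eq_left hr.2]
  have h2 : ∫ r in s..t, Real.exp (-(a * (t - r))) * min r s =
      ∫ r in s..t, Real.exp (-(a * (t - r))) * s :=
    intervalIntegral.integral_congr fun r hr => by
      rw [Set.uIcc_of_le hst] at hr
      simp only [min_eq_right hr.1]
  rw [h1, h2, integral_exp_kernel_mul_id ha, intervalIntegral.integral_mul_const,
    integral_exp_kernel ha]
  simp only [sub_self, mul_zero, neg_zero, Real.exp_zero, sub_zero]
  field_simp
  ring

theorem integral_integral_exp_kernel_mul_min {a : ℝ} (ha : a ≠ 0) {t : ℝ} (ht : 0 ≤ t) :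
    ∫ s in (0 : ℝ)..t, Real.exp (-(a * (t - s))) *
        ∫ r in (0 : ℝ)..t, Real.exp (-(a * (t - r))) * min r s =
      (t / a ^ 2 - 1 / a ^ 3 + Real.exp (-(a * t)) / a ^ 3 - 1 / (2 * a ^ 3)) -
        (Real.exp (-(a * t)) * (Real.exp (-(a * t)) - 1) / a ^ 3 -
          Real.exp (-(a * t)) ^ 2 / (2 * a ^ 3)) := by
  have hcongr : ∫ s in (0 : ℝ)..t, Real.exp (-(a * (t - s))) *
        (∫ r in (0 : ℝ)..t, Real.exp (-(a * (t - r))) * min r s) =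
      ∫ s in (0 : ℝ)..t, Real.exp (-(a * (t - s))) *
        (s / a - (Real.exp (-(a * (t - s))) - Real.exp (-(a * t))) / a ^ 2) :=
    intervalIntegral.integral_congr fun s hs => by
      rw [Set.uIcc_of_le ht] at hs
      simp only [integral_exp_kernel_mul_min ha hs.1 hs.2]
  rw [hcongr, intervalIntegral.integral_eq_sub_of_hasDerivAt
    (f := fun s => Real.exp (-(a * (t - s))) * (s / a ^ 2 - 1 / a ^ 3 + Real.exp (-(a * t)) / a ^ 3)
      - Real.exp (-(a * (t - s))) ^ 2 / (2 * a ^ 3))]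
  · simp only [sub_self, mul_zero, neg_zero, Real.exp_zero, sub_zero]
    field_simp
    ring
  · intro s _
    have he := hasDerivAt_exp_kernel a t s
    refine ((he.mul ((((hasDerivAt_id s).div_const (a ^ 2)).sub_const (1 / a ^ 3)).add_const
      (Real.exp (-(a * t)) / a ^ 3))).sub ((he.pow 2).div_const (2 * a ^ 3))).congr_deriv ?_
    simp only [id]
    field_simp
    ring
  · exact (by fun_prop : Continuous fun s => Real.exp (-(a * (t - s))) *
      (s / a - (Real.exp (-(a * (t - s))) - Real.exp (-(a * t))) / a ^ 2)).intervalIntegrable _ _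

end Scalar

/-! ### Second moments of the Ornstein–Uhlenbeck process -/

section OrnsteinUhlenbeck

variable {Ω : Type u} [MeasurableSpace Ω] {P : Measure Ω} [IsProbabilityMeasure P]

/-- The scalar counterpart of `IsIntegratedWhiteNoise`, with all paths continuous on the whole line,
as needed for joint measurability. Centering plays no role for second moments. -/
structure IsScalarNoise (P : Measure Ω) (w : ℝ → Ω → ℝ) : Prop where
  continuous : ∀ ω, Continuous fun t => w t ω
  measurable : ∀ t, Measurable (w t)
  memLp : ∀ t, 0 ≤ t → MemLp (w t) 2 P
  covariance : ∀ s t, 0 ≤ s → 0 ≤ t → ∫ ω, w s ω * w t ω ∂P = min s t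

variable {w : ℝ → Ω → ℝ}

omit [IsProbabilityMeasure P] in
theorem IsScalarNoise.measurable_uncurry (hw : IsScalarNoise P w) :
    Measurable (Function.uncurry w) :=
  measurable_uncurry_of_continuous_of_measurable hw.continuous hw.measurable

theorem IsScalarNoise.integrable_sq (hw : IsScalarNoise P w) {K : ℝ → ℝ} (hK : Continuous K)
    {t : ℝ} : Integrable (fun p : ℝ × Ω => (K p.1 * w p.1 p.2) ^ 2)
      ((volume.restrict (Set.Ioc 0 t)).prod P) := by
  have hmeas : Measurable fun p : ℝ × Ω => (K p.1 * w p.1 p.2) ^ 2 :=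
    ((hK.measurable.comp measurable_fst).mul hw.measurable_uncurry).pow_const 2
  rw [integrable_prod_iff hmeas.aestronglyMeasurable]
  constructor
  · filter_upwards [ae_restrict_mem measurableSet_Ioc] with s hs
    simp only [mul_pow]
    exact (hw.memLp s hs.1.le).integrable_sq.const_mul _
  · have hint : IntegrableOn (fun s => K s ^ 2 * s) (Set.Ioc 0 t) :=
      ((by fun_prop : Continuous fun s => K s ^ 2 * s).integrableOn_Icc).mono_set
        Set.Ioc_subset_Icc_self
    refine hint.congr ?_
    filter_upwards [ae_restrict_mem measurableSet_Ioc] with s hs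
    have hcov := hw.covariance s s hs.1.le hs.1.le
    rw [min_self] at hcov
    have hnorm : ∀ ω, ‖(K s * w s ω) ^ 2‖ = K s ^ 2 * (w s ω * w s ω) := fun ω => by
      rw [Real.norm_of_nonneg (sq_nonneg _)]; ring
    simp only [hnorm]
    rw [integral_const_mul, hcov]

theorem IsScalarNoise.memLp_integral (hw : IsScalarNoise P w) {K : ℝ → ℝ} (hK : Continuous K)
    {t : ℝ} (ht : 0 ≤ t) : MemLp (fun ω => ∫ s in (0 : ℝ)..t, K s * w s ω) 2 P := by
  have hmeas : StronglyMeasurable fun ω => ∫ s in (0 : ℝ)..t, K s * w s ω := by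
    simp only [intervalIntegral.integral_of_le ht]
    exact StronglyMeasurable.integral_prod_left (f := fun s ω => K s * w s ω)
      ((hK.measurable.comp measurable_fst).mul hw.measurable_uncurry).stronglyMeasurable
  rw [memLp_two_iff_integrable_sq hmeas.aestronglyMeasurable]
  refine ((hw.integrable_sq hK (t := t)).integral_prod_right.const_mul t).mono'
    (hmeas.pow 2).aestronglyMeasurable (ae_of_all _ fun ω => ?_)
  rw [Real.norm_of_nonneg (sq_nonneg _), ← intervalIntegral.integral_of_le ht]
  exact sq_integral_le t ht (hK.mul (hw.continuous ω))

theorem IsScalarNoise.integral_integral_mul (hw : IsScalarNoise P w) {K : ℝ → ℝ}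
    (hK : Continuous K) {t : ℝ} (ht : 0 ≤ t) {g : Ω → ℝ} (hg : MemLp g 2 P) :
    ∫ ω, (∫ s in (0 : ℝ)..t, K s * w s ω) * g ω ∂P =
      ∫ s in (0 : ℝ)..t, K s * ∫ ω, w s ω * g ω ∂P := by
  have hint : Integrable (Function.uncurry fun s ω => K s * w s ω * g ω)
      ((volume.restrict (Set.uIoc 0 t)).prod P) := by
    rw [Set.uIoc_of_le ht]
    have hbound := (hw.integrable_sq hK (t := t)).add
      (hg.integrable_sq.comp_snd (volume.restrict (Set.Ioc 0 t)))
    refine hbound.mono' ?_ (ae_of_all _ fun p => ?_)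
    · exact (((hK.measurable.comp measurable_fst).mul
        hw.measurable_uncurry).aestronglyMeasurable).mul hg.aestronglyMeasurable.comp_snd
    · simp only [Function.uncurry, Pi.add_apply, norm_mul, Real.norm_eq_abs]
      rw [← abs_mul]
      nlinarith [sq_abs (K p.1 * w p.1 p.2), sq_abs (g p.2),
        sq_nonneg (|K p.1 * w p.1 p.2| - |g p.2|), sq_nonneg (|K p.1 * w p.1 p.2|),
        sq_nonneg (|g p.2|)]
  simp only [← intervalIntegral.integral_mul_const]
  rw [← intervalIntegral_integral_swap hint]
  refine intervalIntegral.integral_congr fun s _ => ?_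
  simp only [mul_assoc]
  rw [integral_const_mul]

/-- The solution of `v' = -a v + w'` started at `0`. -/
noncomputable def ornsteinUhlenbeck (a : ℝ) (w : ℝ → Ω → ℝ) (t : ℝ) (ω : Ω) : ℝ :=
  w t ω - a * ∫ s in (0 : ℝ)..t, Real.exp (-(a * (t - s))) * w s ω

theorem IsScalarNoise.memLp_ornsteinUhlenbeck (hw : IsScalarNoise P w) (a : ℝ) {t : ℝ}
    (ht : 0 ≤ t) : MemLp (ornsteinUhlenbeck a w t) 2 P :=
  (hw.memLp t ht).sub ((hw.memLp_integral (by fun_prop) ht).const_mul a)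

theorem IsScalarNoise.integral_sq_ornsteinUhlenbeck (hw : IsScalarNoise P w) {a : ℝ} (ha : a ≠ 0)
    {t : ℝ} (ht : 0 ≤ t) :
    ∫ ω, ornsteinUhlenbeck a w t ω ^ 2 ∂P = (1 - Real.exp (-(a * t)) ^ 2) / (2 * a) := by
  have hK : Continuous fun s => Real.exp (-(a * (t - s))) := by fun_prop
  have hI := hw.memLp_integral hK ht
  have hwt := hw.memLp t ht
  have hIw : ∀ s, 0 ≤ s → ∫ ω, (∫ r in (0 : ℝ)..t, Real.exp (-(a * (t - r))) * w r ω) * w s ω ∂P =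
      ∫ r in (0 : ℝ)..t, Real.exp (-(a * (t - r))) * min r s := by
    intro s hs
    rw [hw.integral_integral_mul hK ht (hw.memLp s hs)]
    refine intervalIntegral.integral_congr fun r hr => ?_
    rw [Set.uIcc_of_le ht] at hr
    simp only [hw.covariance r s hr.1 hs]
  have hII : ∫ ω, (∫ r in (0 : ℝ)..t, Real.exp (-(a * (t - r))) * w r ω) *
      (∫ r in (0 : ℝ)..t, Real.exp (-(a * (t - r))) * w r ω) ∂P =
      ∫ s in (0 : ℝ)..t, Real.exp (-(a * (t - s))) *
        ∫ r in (0 : ℝ)..t, Real.exp (-(a * (t - r))) * min r s := by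
    rw [hw.integral_integral_mul hK ht hI]
    refine intervalIntegral.integral_congr fun s hs => ?_
    rw [Set.uIcc_of_le ht] at hs
    simp only [← hIw s hs.1, mul_comm (w s _)]
  have hexp : ∀ ω, ornsteinUhlenbeck a w t ω ^ 2 = w t ω * w t ω -
      2 * a * ((∫ r in (0 : ℝ)..t, Real.exp (-(a * (t - r))) * w r ω) * w t ω) +
      a ^ 2 * ((∫ r in (0 : ℝ)..t, Real.exp (-(a * (t - r))) * w r ω) *
        (∫ r in (0 : ℝ)..t, Real.exp (-(a * (t - r))) * w r ω)) := fun ω => by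
    rw [ornsteinUhlenbeck]; ring
  have i1 : Integrable (fun ω => w t ω * w t ω) P := hwt.integrable_mul hwt
  have i2 : Integrable (fun ω => 2 * a *
      ((∫ r in (0 : ℝ)..t, Real.exp (-(a * (t - r))) * w r ω) * w t ω)) P :=
    (hI.integrable_mul hwt).const_mul _
  have i3 : Integrable (fun ω => a ^ 2 *
      ((∫ r in (0 : ℝ)..t, Real.exp (-(a * (t - r))) * w r ω) *
        (∫ r in (0 : ℝ)..t, Real.exp (-(a * (t - r))) * w r ω))) P :=
    (hI.integrable_mul hI).const_mul _
  have i12 : Integrable (fun ω => w t ω * w t ω - 2 * a *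
      ((∫ r in (0 : ℝ)..t, Real.exp (-(a * (t - r))) * w r ω) * w t ω)) P := i1.sub i2
  simp only [hexp]
  rw [integral_add i12 i3, integral_sub i1 i2, integral_const_mul, integral_const_mul,
    hw.covariance t t ht ht, hIw t ht, hII, min_self, integral_exp_kernel_mul_min ha ht le_rfl,
    integral_integral_exp_kernel_mul_min ha ht]
  simp only [sub_self, mul_zero, neg_zero, Real.exp_zero]
  field_simp
  ring

/-- The initial state is forgotten at an exponential rate, without any independence from the
noise: its product with the noise part is controlled by the two second moments. -/
theorem IsScalarNoise.tendsto_integral_sq (hw : IsScalarNoise P w) {a : ℝ} (ha : 0 < a)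
    {z₀ : Ω → ℝ} (hz₀ : MemLp z₀ 2 P) :
    Tendsto (fun t => ∫ ω, (Real.exp (-(a * t)) * z₀ ω + ornsteinUhlenbeck a w t ω) ^ 2 ∂P) atTop
      (𝓝 ((1 / 2) * a⁻¹)) := by
  have hexp0 : Tendsto (fun t => Real.exp (-(a * t))) atTop (𝓝 0) :=
    Real.tendsto_exp_neg_atTop_nhds_zero.comp (tendsto_id.const_mul_atTop ha)
  have hv : Tendsto (fun t => (1 - Real.exp (-(a * t)) ^ 2) / (2 * a)) atTop
      (𝓝 ((1 / 2) * a⁻¹)) := by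
    have := ((tendsto_const_nhds (x := (1 : ℝ))).sub (hexp0.pow 2)).div_const (2 * a)
    convert this using 2
    field_simp
    ring
  have hcross : Tendsto (fun t => Real.exp (-(a * t)) *
      (2 * ∫ ω, z₀ ω * ornsteinUhlenbeck a w t ω ∂P)) atTop (𝓝 0) := by
    refine squeeze_zero_norm' (a := fun t => Real.exp (-(a * t)) *
      ((∫ ω, z₀ ω ^ 2 ∂P) + (1 - Real.exp (-(a * t)) ^ 2) / (2 * a))) ?_ ?_
    · filter_upwards [eventually_ge_atTop 0] with t ht
      have hvt := hw.memLp_ornsteinUhlenbeck a ht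
      rw [norm_mul, Real.norm_of_nonneg (Real.exp_nonneg _),
        ← hw.integral_sq_ornsteinUhlenbeck ha.ne' ht,
        ← integral_add hz₀.integrable_sq hvt.integrable_sq, ← integral_const_mul]
      refine mul_le_mul_of_nonneg_left ?_ (Real.exp_nonneg _)
      refine norm_integral_le_of_norm_le (hz₀.integrable_sq.add hvt.integrable_sq)
        (ae_of_all _ fun ω => ?_)
      rw [Real.norm_eq_abs, abs_le]
      constructor <;> nlinarith [sq_nonneg (z₀ ω + ornsteinUhlenbeck a w t ω),
        sq_nonneg (z₀ ω - ornsteinUhlenbeck a w t ω)]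
    · simpa using hexp0.mul ((tendsto_const_nhds (x := ∫ ω, z₀ ω ^ 2 ∂P)).add hv)
  have hfirst : Tendsto (fun t => Real.exp (-(a * t)) ^ 2 * ∫ ω, z₀ ω ^ 2 ∂P) atTop (𝓝 0) := by
    simpa using (hexp0.pow 2).mul_const (∫ ω, z₀ ω ^ 2 ∂P)
  have hsum := (hfirst.add hcross).add hv
  rw [zero_add, zero_add] at hsum
  refine hsum.congr' ?_
  filter_upwards [eventually_ge_atTop 0] with t ht
  have hvt := hw.memLp_ornsteinUhlenbeck a ht
  have hsq : ∀ ω, (Real.exp (-(a * t)) * z₀ ω + ornsteinUhlenbeck a w t ω) ^ 2 =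
      Real.exp (-(a * t)) ^ 2 * z₀ ω ^ 2 +
        Real.exp (-(a * t)) * (2 * (z₀ ω * ornsteinUhlenbeck a w t ω)) +
        ornsteinUhlenbeck a w t ω ^ 2 := fun ω => by ring
  have i1 := hz₀.integrable_sq.const_mul (Real.exp (-(a * t)) ^ 2)
  have i2 : Integrable (fun ω => Real.exp (-(a * t)) *
      (2 * (z₀ ω * ornsteinUhlenbeck a w t ω))) P :=
    ((hz₀.integrable_mul hvt).const_mul 2).const_mul _
  have i12 : Integrable (fun ω => Real.exp (-(a * t)) ^ 2 * z₀ ω ^ 2 +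
      Real.exp (-(a * t)) * (2 * (z₀ ω * ornsteinUhlenbeck a w t ω))) P := i1.add i2
  simp only [hsq]
  rw [integral_add i12 hvt.integrable_sq, integral_add i1 i2, integral_const_mul,
    integral_const_mul, integral_const_mul, hw.integral_sq_ornsteinUhlenbeck ha.ne' ht]

end OrnsteinUhlenbeck

/-! ### The performance measure of the network -/

section Network

open Matrix

variable {V : Type v} [Fintype V] [DecidableEq V] {Ω : Type u} [MeasurableSpace Ω] {P : Measure Ω}
  [IsProbabilityMeasure P]

omit [IsProbabilityMeasure P] in
/-- A unit combination of the coordinates of an integrated white noise is a scalar noise, once the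
null set of discontinuous paths is removed and the time axis is extended. -/
theorem IsIntegratedWhiteNoise.exists_isScalarNoise {W : ℝ → Ω → V → ℝ}
    (hW : IsIntegratedWhiteNoise P W) {c : V → ℝ} (hc : c ⬝ᵥ c = 1) :
    ∃ w : ℝ → Ω → ℝ, IsScalarNoise P w ∧ ∀ᵐ ω ∂P, ∀ t, 0 ≤ t → w t ω = c ⬝ᵥ W t ω := by
  classical
  obtain ⟨N, hN, hNm, hN0⟩ := exists_measurable_superset_of_null (ae_iff.1 hW.continuousOn)
  have hae : ∀ᵐ ω ∂P, ω ∉ N := measure_eq_zero_iff_ae_notMem.1 hN0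
  have hval : ∀ t, 0 ≤ t → (fun ω => if ω ∈ N then 0 else c ⬝ᵥ W (max t 0) ω) =ᵐ[P]
      fun ω => c ⬝ᵥ W t ω := fun t ht => by
    filter_upwards [hae] with ω hω
    rw [if_neg hω, max_eq_left ht]
  have hmem : ∀ t, 0 ≤ t → MemLp (fun ω => c ⬝ᵥ W t ω) 2 P := fun t ht =>
    memLp_finsetSum _ fun i _ => (hW.memLp t ht i).const_mul (c i)
  refine ⟨fun t ω => if ω ∈ N then 0 else c ⬝ᵥ W (max t 0) ω,
    ⟨fun ω => ?_, fun t => ?_, fun t ht => ?_, fun s t hs ht => ?_⟩, ?_⟩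
  · by_cases hω : ω ∈ N
    · simpa only [if_pos hω] using continuous_const
    · simp only [if_neg hω]
      have hcont : ContinuousOn (fun t => W t ω) (Set.Ici 0) := by
        by_contra h
        exact hω (hN h)
      have hcont' : Continuous fun t : ℝ => W (max t 0) ω :=
        hcont.comp_continuous (continuous_id.max continuous_const) fun t =>
          Set.mem_Ici.2 (le_max_right _ _)
      exact continuous_finsetSum _ fun i _ =>
        continuous_const.mul ((continuous_apply i).comp hcont')
  · refine Measurable.ite hNm measurable_const ?_
    exact Finset.measurable_sum _ fun i _ =>
      ((measurable_pi_apply i).comp (hW.measurable _ (le_max_right t 0))).const_mul (c i)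
  · exact (memLp_congr_ae (hval t ht)).2 (hmem t ht)
  · refine (integral_congr_ae ((hval s hs).mul (hval t ht))).trans ?_
    have hexp : ∀ ω, (c ⬝ᵥ W s ω) * (c ⬝ᵥ W t ω) =
        ∑ i, ∑ j, c i * c j * (W s ω i * W t ω j) := fun ω => by
      simp only [dotProduct, Finset.sum_mul_sum]
      exact Finset.sum_congr rfl fun i _ => Finset.sum_congr rfl fun j _ => by ring
    have hint : ∀ i j, Integrable (fun ω => c i * c j * (W s ω i * W t ω j)) P := fun i j =>
      ((hW.memLp s hs i).integrable_mul (hW.memLp t ht j)).const_mul _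
    simp only [Pi.mul_apply, hexp]
    rw [integral_finsetSum _ fun i _ => integrable_finsetSum _ fun j _ => hint i j]
    simp only [integral_finsetSum _ fun j _ => hint _ j, integral_const_mul,
      hW.covariance s t hs ht, mul_ite, mul_zero, Finset.sum_ite_eq, Finset.mem_univ, if_true,
      ← Finset.sum_mul]
    rw [show ∑ i, c i * c i = 1 from hc, one_mul]
  · filter_upwards [hae] with ω hω t ht
    rw [if_neg hω, max_eq_left ht]

omit [DecidableEq V] [IsProbabilityMeasure P] in
/-- The component of a trajectory along a left eigenvector of the system matrix solves a scalar
equation. -/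
theorem IsTrajectory.dotProduct_eq {A : Matrix V V ℝ} {W x : ℝ → Ω → V → ℝ}
    (hx : IsTrajectory P A W x) {c : V → ℝ} {a : ℝ}
    (hc : ∀ y : V → ℝ, c ⬝ᵥ (A *ᵥ y) = a * (c ⬝ᵥ y)) :
    ∀ᵐ ω ∂P, ∀ t, 0 ≤ t → c ⬝ᵥ x t ω =
      c ⬝ᵥ x 0 ω - a * (∫ s in (0 : ℝ)..t, c ⬝ᵥ x s ω) + c ⬝ᵥ W t ω := by
  filter_upwards [hx.continuousOn, hx.equation] with ω hcont heq t ht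
  have hsub : Set.uIcc 0 t ⊆ Set.Ici 0 := by
    rw [Set.uIcc_of_le ht]
    exact Set.Icc_subset_Ici_self
  have hint : ∀ i, IntervalIntegrable (fun s => c i * -(A *ᵥ x s ω) i) volume 0 t := by
    intro i
    refine ContinuousOn.intervalIntegrable (continuousOn_const.mul (ContinuousOn.neg ?_))
    exact (continuousOn_finsetSum _ fun j _ => continuousOn_const.mul
      ((continuous_apply j).comp_continuousOn hcont)).mono hsub
  have hkey : ∑ i, c i * ∫ s in (0 : ℝ)..t, -(A *ᵥ x s ω) i =
      -(a * ∫ s in (0 : ℝ)..t, c ⬝ᵥ x s ω) := by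
    simp only [← intervalIntegral.integral_const_mul]
    rw [← intervalIntegral.integral_finsetSum fun i _ => hint i,
      ← intervalIntegral.integral_neg]
    refine intervalIntegral.integral_congr fun s _ => ?_
    simp only [mul_neg, Finset.sum_neg_distrib]
    rw [← hc]
    rfl
  calc c ⬝ᵥ x t ω = ∑ i, c i * (x 0 ω i + (∫ s in (0 : ℝ)..t, -(A *ᵥ x s ω) i) + W t ω i) :=
        Finset.sum_congr rfl fun i _ => by rw [heq t ht i]
    _ = c ⬝ᵥ x 0 ω + (∑ i, c i * ∫ s in (0 : ℝ)..t, -(A *ᵥ x s ω) i) + c ⬝ᵥ W t ω := by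
        simp only [mul_add, Finset.sum_add_distrib, dotProduct]
    _ = _ := by rw [hkey]; ring

/-- Along a nonzero eigenvalue, the component of the state has a stationary variance. -/
theorem tendsto_integral_sq_dotProduct {A : Matrix V V ℝ} {W x : ℝ → Ω → V → ℝ}
    (hW : IsIntegratedWhiteNoise P W) (hx : IsTrajectory P A W x) {c : V → ℝ} {a : ℝ} (ha : 0 < a)
    (hc1 : c ⬝ᵥ c = 1) (hc : ∀ y : V → ℝ, c ⬝ᵥ (A *ᵥ y) = a * (c ⬝ᵥ y)) :
    (∀ t, 0 ≤ t → Integrable (fun ω => (c ⬝ᵥ x t ω) ^ 2) P) ∧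
      Tendsto (fun t => ∫ ω, (c ⬝ᵥ x t ω) ^ 2 ∂P) atTop (𝓝 ((1 / 2) * a⁻¹)) := by
  obtain ⟨w, hw, hwW⟩ := hW.exists_isScalarNoise hc1
  have hz₀ : MemLp (fun ω => c ⬝ᵥ x 0 ω) 2 P :=
    memLp_finsetSum _ fun i _ => (hx.initial i).const_mul (c i)
  have hae : ∀ t, 0 ≤ t → (fun ω => (c ⬝ᵥ x t ω) ^ 2) =ᵐ[P] fun ω =>
      (Real.exp (-(a * t)) * (c ⬝ᵥ x 0 ω) + ornsteinUhlenbeck a w t ω) ^ 2 := by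
    intro t ht
    filter_upwards [hwW, hx.dotProduct_eq hc, hx.continuousOn] with ω h1 h2 h3
    have hcz : ContinuousOn (fun s => c ⬝ᵥ x s ω) (Set.Ici 0) :=
      continuousOn_finsetSum _ fun i _ => continuousOn_const.mul
        ((continuous_apply i).comp_continuousOn h3)
    rw [eq_of_integral_equation hcz (hw.continuous ω)
      (fun s hs => by rw [h2 s hs, h1 s hs]) ht, ornsteinUhlenbeck]
  refine ⟨fun t ht => ?_, ?_⟩
  · exact (integrable_congr (hae t ht)).2
      ((hz₀.const_mul _).add (hw.memLp_ornsteinUhlenbeck a ht)).integrable_sq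
  · refine (hw.tendsto_integral_sq ha hz₀).congr' ?_
    filter_upwards [eventually_ge_atTop 0] with t ht
    exact (integral_congr_ae (hae t ht)).symm

/-- The output energy is the sum of the energies of the modes with nonzero eigenvalue, each of which
settles at `1 / (2 μ)`. -/
theorem hasPerformanceMeasure_rhoSS {G : SimpleGraph V} [DecidableRel G.Adj] (hG : G.Connected) :
    HasPerformanceMeasure.{u, v} (G.lapMatrix ℝ) (centeringMatrix V) (rhoSS G) := by
  intro m C hC Ω _ P _ W x hW hx
  have hmode : ∀ k, lapEigenvalueAt G k ≠ 0 → _ := fun k hk =>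
    tendsto_integral_sq_dotProduct hW hx ((lapEigenvalueAt_nonneg G k).lt_of_ne' hk)
      ((lapEigenvector_dotProduct_lapEigenvector G k k).trans (if_pos rfl))
      (lapEigenvector_dotProduct_mulVec G k)
  have hout : ∀ t ω, C *ᵥ x t ω ⬝ᵥ C *ᵥ x t ω =
      ∑ k with lapEigenvalueAt G k ≠ 0, (lapEigenvector G k ⬝ᵥ x t ω) ^ 2 := fun t ω => by
    rw [← dotProduct_centeringMatrix hG, ← hC, ← mulVec_mulVec, dotProduct_mulVec (x t ω),
      vecMul_transpose]
  simp only [hout]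
  refine ⟨fun t ht => integrable_finsetSum _ fun k hk =>
    (hmode k (Finset.mem_filter.1 hk).2).1 t ht, ?_⟩
  have hrho : rhoSS G = ∑ k with lapEigenvalueAt G k ≠ 0, (1 / 2) * (lapEigenvalueAt G k)⁻¹ := by
    rw [rhoSS_eq_sum hG, Finset.mul_sum, Finset.sum_filter]
    refine Finset.sum_congr rfl fun k _ => ?_
    split_ifs with hk
    · rfl
    · rw [not_not.1 hk, _root_.inv_zero, mul_zero]
  rw [hrho]
  refine (tendsto_finsetSum _ fun k hk => (hmode k (Finset.mem_filter.1 hk).2).2).congr' ?_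
  filter_upwards [eventually_ge_atTop 0] with t ht
  exact (integral_finsetSum _ fun k hk => (hmode k (Finset.mem_filter.1 hk).2).1 t ht).symm

end Network

end ConsensusNetwork

theorem theorem3 {V : Type v} [Fintype V] [DecidableEq V] {n : ℕ} (hn : Fintype.card V = n)
    (G : SimpleGraph V) [DecidableRel G.Adj] (hG : G.Connected) :
    ConsensusNetwork.HasPerformanceMeasure.{u, v} (G.lapMatrix ℝ)
        (ConsensusNetwork.centeringMatrix V) (ConsensusNetwork.rhoSS G) ∧
      1 / 2 - 1 / (2 * (n : ℝ)) ≤ ConsensusNetwork.rhoSS G ∧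
      ConsensusNetwork.rhoSS G ≤ ((n : ℝ) ^ 2 - 1) / 12 ∧
      (ConsensusNetwork.rhoSS G = 1 / 2 - 1 / (2 * (n : ℝ)) ↔
        Nonempty (G ≃g SimpleGraph.completeGraph (Fin n))) ∧
      (ConsensusNetwork.rhoSS G = ((n : ℝ) ^ 2 - 1) / 12 ↔
        Nonempty (G ≃g SimpleGraph.pathGraph n)) := by
  subst hn
  refine ⟨ConsensusNetwork.hasPerformanceMeasure_rhoSS hG, ConsensusNetwork.rhoSS_ge hG,
    ConsensusNetwork.rhoSS_le hG, (ConsensusNetwork.rhoSS_eq_lower_iff hG).trans ⟨?_, ?_⟩,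
    ConsensusNetwork.rhoSS_eq_upper_iff hG⟩
  · rintro rfl
    exact ⟨SimpleGraph.Iso.completeGraph (Fintype.equivFin V)⟩
  · rintro ⟨φ⟩
    ext a b
    rw [← φ.map_adj_iff]
    simp [φ.injective.ne_iff]
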